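/- **Theorem 4.1 (T1).** Let $r\ge 1$ be an integer. There are positive numbers $\kappa(d,r)$, depending only on $d$ and $r$, and a positive number $\kappa'(r)$, depending only on $r$, with the following property. Let $\mathbf w=(1,1,w_2,\dots,w_{r+1})$ be a vector of positive integers, and let $X$ be the hypersurface $F=0$ in the weighted projective space $\mathbb P_{\mathbb Q}(\mathbf w)$, where $F\in\mathbb Z[x_0,\dots,x_{r+1}]$ is a primitive form (the greatest common divisor of its coefficients is $1$) that is weighted homogeneous of weighted degree $d$, the variable $x_i$ having weight $w_i$. Let $p$ be a prime, let $X_p$ be the hypersurface over $\mathbb F_p$ defined by the reduction of $F$ modulo $p$, and let $P$ be an $\mathbb F_p$-point of $X_p$. Let $s\ge 1$ and let $\boldsymbol\xi_1,\dots,\boldsymbol\xi_s\in\mathbb Z^{r+2}$ be distinct tuples, $\boldsymbol\xi_l=(\xi_{0,l},\dots,\xi_{r+1,l})$, such that $F(\boldsymbol\xi_l)=0$, $\gcd(\xi_{0,l},\xi_{1,l})=1$, and $\boldsymbol\xi_l \bmod p$ represents $P$, for every $l$. Let $m_P$ be the multiplicity of $P$ on $X_p$, that is, the order of vanishing at $P$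 of the local equation of $X_p$ in an affine chart $x_i=1$ with $w_i=1$ containing $P$ (such a chart exists, and the order does not depend on it). Let $M_1,\dots,M_s$ be monomials in $x_0,\dots,x_{r+1}$ of the same weighted degree. Then there is a non-negative integer $N$ such that $p^N$ divides the determinant of the $s\times s$ matrix $(M_j(\boldsymbol\xi_l))_{j,l}$ and $$N>\left(\frac{r!}{m_P}\right)^{1/r}\frac{r}{r+1}\,s^{1+1/r}-\kappa(d,r)\,s,$$ and such that, if $P$ is a nonsingular point of $X_p$, also $$N>(r!)^{1/r}\,\frac{r}{r+1}\,s^{1+1/r}-\kappa'(r)\,s.$$ -/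

import Mathlib

open MvPolynomial

/-- Two nonzero coordinate vectors are identified when one is obtained from the other by the weighted
scaling `x i ↦ c ^ w i * x i` with `c` a nonzero scalar. -/
def weightedSetoid {ι : Type*} (w : ι → ℕ) (k : Type*) [Field k] :
    Setoid {x : ι → k // x ≠ 0} where
  r x y := ∃ c : kˣ, ∀ i, x.1 i = (c : k) ^ w i * y.1 i
  iseqv :=
    { refl := fun x => ⟨1, fun i => by simp⟩
      symm := by
        rintro x y ⟨c, h⟩
        refine ⟨c⁻¹, fun i => ?_⟩
        rw [h i, ← mul_assoc, ← mul_pow]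
        simp
      trans := by
        rintro x y z ⟨c, h⟩ ⟨e, h'⟩
        refine ⟨c * e, fun i => ?_⟩
        rw [h i, h' i, Units.val_mul, mul_pow, mul_assoc] }

/-- The set of points of the weighted projective space over `k` with weight vector `w`. -/
def WeightedProjectiveSpace {ι : Type*} (w : ι → ℕ) (k : Type*) [Field k] : Type _ :=
  Quotient (weightedSetoid w k)

namespace WeightedProjectiveSpace

variable {ι : Type*} {w : ι → ℕ} {k : Type*} [Field k]

/-- `x` is a vector of weighted homogeneous coordinates of the point `P`. -/
def IsRep (P : WeightedProjectiveSpace w k) (x : ι → k) : Prop :=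
  ∃ h : x ≠ 0, (Quotient.mk (weightedSetoid w k) ⟨x, h⟩ : WeightedProjectiveSpace w k) = P

/-- The set of points of the hypersurface `F = 0`. -/
def zeroLocus (w : ι → ℕ) (F : MvPolynomial ι k) : Set (WeightedProjectiveSpace w k) :=
  {P | ∀ x : ι → k, P.IsRep x → eval x F = 0}

open Classical in
/-- The equation of the hypersurface `F = 0` in the affine chart `x i = 1`. When `w i = 1`, this
chart is an affine space with the remaining variables as coordinates. -/
noncomputable def dehomogenize (i : ι) (F : MvPolynomial ι k) :
    MvPolynomial {j : ι // j ≠ i} k :=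
  aeval (fun j => if h : j = i then 1 else X ⟨j, h⟩) F

/-- The maximal ideal of polynomials vanishing at the point `a` of affine space. -/
noncomputable def pointIdeal {σ : Type*} (a : σ → k) : Ideal (MvPolynomial σ k) :=
  RingHom.ker (eval a)

/-- The multiplicity of the point `P` on the hypersurface `F = 0`: the largest `n` such that the
local equation of the hypersurface at `P` lies in the `n`-th power of the maximal ideal at `P`.
It is used for points `P` that lie in some chart `x i = 1` with `w i = 1`; there the local equation
is the equation in that chart, and `P` has exactly one coordinate vector with `x i = 1`. Any two
such charts are isomorphic near `P` and the two local equations differ by a unit, so all the charts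
that contain `P` give the same number. -/
noncomputable def multiplicity (F : MvPolynomial ι k) (P : WeightedProjectiveSpace w k) : ℕ :=
  sSup {n : ℕ | ∃ (i : ι) (x : ι → k), w i = 1 ∧ x i = 1 ∧ P.IsRep x ∧
    dehomogenize i F ∈ pointIdeal (fun j : {j : ι // j ≠ i} => x j) ^ n}

/-- `P` is a nonsingular point of the hypersurface `F = 0`: the local equation vanishes at `P` and
some partial derivative of it does not (again in a chart `x i = 1` with `w i = 1`). -/
def IsNonsingular (F : MvPolynomial ι k) (P : WeightedProjectiveSpace w k) : Prop :=
  ∃ (i : ι) (x : ι → k), w i = 1 ∧ x i = 1 ∧ P.IsRep x ∧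
    eval (fun j : {j : ι // j ≠ i} => x j) (dehomogenize i F) = 0 ∧
    ∃ j : {j : ι // j ≠ i},
      eval (fun j : {j : ι // j ≠ i} => x j) (pderiv j (dehomogenize i F)) ≠ 0

end WeightedProjectiveSpace

/-- An integral form is primitive if its coefficients have no common divisor except `1` and `-1`. -/
def IsPrimitiveForm {ι : Type*} (F : MvPolynomial ι ℤ) : Prop :=
  ∀ c : ℤ, (∀ m, c ∣ coeff m F) → IsUnit c

/-- The form `F` reduced modulo `p`. -/
noncomputable def reduceForm {ι : Type*} (p : ℕ) (F : MvPolynomial ι ℤ) :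
    MvPolynomial ι (ZMod p) :=
  map (Int.castRingHom (ZMod p)) F

/-! After weighted scaling all the points lie in one chart `x i = 1` with `w i = 1`, and there they
are congruent modulo `p` to one integral vector `a`, so they have the form `a + p * t l`. A local
monomial of degree `k` in the coordinates centred at `a` takes values divisible by `p ^ k`, so a
determinant built from local monomials is divisible by `p` to the power of the sum of their degrees.

The equation of the hypersurface reduces the supply of small degrees. Let `β` be the exponent of the
lowest monomial, in a degree order, of the local equation modulo `p`. Over `ℤ / p ^ N` the equation
rewrites a multiple of this monomial through higher monomials and an error divisible by `p`.
Monomials of degree at least `N` have value zero and `p` is nilpotent, so the rewriting terminates: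
the monomials that are not multiples of `β` span all value vectors (`evalVec_mem_span`). Multilinear
expansion then leaves only determinants of distinct monomials of this kind (`det_eval_eq_zero`).

At most `β.degree * (k + r).choose r` of them have degree at most `k`. Hence the `j`-th smallest
degree is at least `(r! * j / β.degree) ^ (1 / r) - r`, and summation over `j ≤ s` gives the main
term (`sum_degree_lower_bound`). Finally `β.degree` is the order of the local equation: it is at
most the multiplicity, and it is one at a nonsingular point. -/

/-! ### Reduction by the local equation and the determinant -/

/-- The vector of the values of a polynomial at finitely many points. -/
noncomputable def evalVec {n σ R : Type*} [CommRing R] (z : n → σ → R) :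
    MvPolynomial σ R →ₗ[R] (n → R) :=
  LinearMap.pi fun l => (aeval (z l)).toLinearMap

theorem evalVec_apply {n σ R : Type*} [CommRing R] (z : n → σ → R) (h : MvPolynomial σ R) (l : n) :
    evalVec z h l = eval (z l) h := by
  simp [evalVec, aeval_eq_eval]

theorem evalVec_eq_sum {n σ R : Type*} [CommRing R] (z : n → σ → R) (h : MvPolynomial σ R)
    (δ : σ →₀ ℕ) :
    evalVec z (monomial δ 1 * h) = ∑ ε ∈ h.support, coeff ε h • evalVec z (monomial (δ + ε) 1) := by
  conv_lhs => rw [h.as_sum, Finset.mul_sum, map_sum]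
  refine Finset.sum_congr rfl fun ε _ => ?_
  rw [← map_smul, monomial_mul, smul_monomial, one_mul, smul_eq_mul, mul_one]

/-- If the coordinates of the point `z` are `π * t i`, then the monomial of degree `k` takes at `z`
the value that it takes at `t`, multiplied by `π ^ k`. -/
theorem eval_monomial_mul {σ R : Type*} [Fintype σ] [CommRing R] (π : R) (t : σ → R)
    (γ : σ →₀ ℕ) :
    eval (fun i => π * t i) (monomial γ 1) = π ^ γ.degree * eval t (monomial γ 1) := by
  rw [eval_monomial, eval_monomial, one_mul, one_mul,
    Finsupp.prod_fintype _ _ (fun _ => pow_zero _), Finsupp.prod_fintype _ _ (fun _ => pow_zero _),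
    Finsupp.degree_eq_sum, ← Finset.prod_pow_eq_pow_sum, ← Finset.prod_mul_distrib]
  simp only [mul_pow]

/-- Reduction with respect to a local equation: modulo a power of `π`, the value vectors of the
monomials that are not divisible by the initial monomial of `g` span all value vectors. -/
theorem evalVec_mem_span {n σ R : Type*} [Fintype σ] [CommRing R] (mo : MonomialOrder σ)
    (π : R) (N : ℕ) (hπ : π ^ N = 0) (t : n → σ → R) (g : MvPolynomial σ R) (β : σ →₀ ℕ)
    (hg : ∀ l, eval (fun i => π * t l i) g = 0) (hβ : IsUnit (coeff β g))
    (hlow : ∀ γ, mo.toSyn γ < mo.toSyn β → π ∣ coeff γ g) (h : MvPolynomial σ R) :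
    evalVec (fun l i => π * t l i) h ∈ Submodule.span R
      (Set.range fun γ : {γ : σ →₀ ℕ // ¬ β ≤ γ} =>
        evalVec (fun l i => π * t l i) (monomial γ.1 1)) := by
  classical
  set z : n → σ → R := fun l i => π * t l i with hz
  set S := Submodule.span R
      (Set.range fun γ : {γ : σ →₀ ℕ // ¬ β ≤ γ} => evalVec z (monomial γ.1 1)) with hS
  -- The argument is of Nakayama type: all value vectors are shown to lie in `Q`, that is, in `S` up
  -- to a multiple of `π`, and the nilpotency of `π` removes the error.
  set Q := S ⊔ (LinearMap.range (evalVec z)).map (LinearMap.lsmul R (n → R) π) with hQ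
  have hvan : ∀ γ : σ →₀ ℕ, N ≤ γ.degree → evalVec z (monomial γ 1) = 0 := by
    intro γ hγ
    funext l
    rw [evalVec_apply, eval_monomial_mul, pow_eq_zero_of_le hγ hπ, zero_mul, Pi.zero_apply]
  have hfin : {γ : σ →₀ ℕ | γ.degree ≤ N}.Finite := Finsupp.finite_of_degree_le N
  -- Descending induction along the monomial order, measured by the number of larger monomials of
  -- degree at most `N`. It is finite because monomials of degree at least `N` have value zero.
  have hmono : ∀ (c : ℕ) (γ : σ →₀ ℕ),
      (hfin.toFinset.filter fun ε => mo.toSyn γ < mo.toSyn ε).card = c →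
      evalVec z (monomial γ 1) ∈ Q := by
    intro c
    induction c using Nat.strong_induction_on with
    | _ c ih =>
      intro γ hc
      by_cases hle : β ≤ γ
      swap
      · exact Submodule.mem_sup_left (Submodule.subset_span ⟨⟨γ, hle⟩, rfl⟩)
      obtain ⟨δ, rfl⟩ := exists_add_of_le hle
      have h0 : evalVec z (monomial δ 1 * g) = 0 := by
        funext l
        rw [evalVec_apply, map_mul, hg l, mul_zero, Pi.zero_apply]
      rw [evalVec_eq_sum] at h0
      -- A unit coefficient can be zero only in the zero ring, which does occur in the application,
      -- for `N = 0`.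
      by_cases hβ0 : coeff β g = 0
      · have : Subsingleton R := by
          rw [hβ0] at hβ
          exact subsingleton_of_zero_eq_one (isUnit_zero_iff.1 hβ)
        rw [Subsingleton.elim (evalVec z (monomial (β + δ) 1)) 0]
        exact Q.zero_mem
      rw [← Finset.add_sum_erase _ _ (mem_support_iff.2 hβ0)] at h0
      -- Terms of `g` below `β` carry a factor `π`; terms above it give monomials that have value
      -- zero or are covered by the induction.
      have hrest : ∑ ε ∈ g.support.erase β, coeff ε g • evalVec z (monomial (δ + ε) 1) ∈ Q := by
        refine Submodule.sum_mem _ fun ε hε => ?_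
        rcases lt_trichotomy (mo.toSyn ε) (mo.toSyn β) with hlt | heq | hgt
        · obtain ⟨a, ha⟩ := hlow ε hlt
          rw [ha, mul_smul, ← map_smul]
          exact Submodule.mem_sup_right (Submodule.mem_map_of_mem ⟨_, rfl⟩)
        · exact absurd (mo.toSyn.injective heq) (Finset.ne_of_mem_erase hε)
        · refine Q.smul_mem _ ?_
          by_cases hN : N ≤ (δ + ε).degree
          · rw [hvan _ hN]; exact Q.zero_mem
          · have hlt : mo.toSyn (β + δ) < mo.toSyn (δ + ε) := by
              rw [add_comm β δ, map_add, map_add]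
              exact add_lt_add_right hgt _
            refine ih _ ?_ _ rfl
            rw [← hc]
            refine Finset.card_lt_card (Finset.ssubset_iff_of_subset ?_ |>.2 ⟨δ + ε, ?_, ?_⟩)
            · intro x hx
              simp only [Finset.mem_filter] at hx ⊢
              exact ⟨hx.1, hlt.trans hx.2⟩
            · simp only [Finset.mem_filter, Set.Finite.mem_toFinset, Set.mem_ofPred_eq]
              exact ⟨(not_le.1 hN).le, hlt⟩
            · simp
      have hmem : coeff β g • evalVec z (monomial (δ + β) 1) ∈ Q := by
        rw [eq_neg_of_add_eq_zero_left h0]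
        exact Q.neg_mem hrest
      rw [add_comm β δ]
      obtain ⟨v, hv⟩ := hβ
      rw [← hv] at hmem
      have := Q.smul_mem (↑v⁻¹ : R) hmem
      rwa [smul_smul, Units.inv_mul, one_smul] at this
  have hall : ∀ f, evalVec z f ∈ Q := by
    intro f
    have := evalVec_eq_sum z f 0
    rw [monomial_zero', C_1, one_mul] at this
    rw [this]
    exact Submodule.sum_mem _ fun ε _ => Q.smul_mem _ (hmono _ _ rfl)
  have hstep : ∀ f, ∃ f', evalVec z f - π • evalVec z f' ∈ S := by
    intro f
    obtain ⟨a, ha, b, ⟨_, ⟨f', rfl⟩, rfl⟩, hab⟩ := Submodule.mem_sup.1 (hall f)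
    refine ⟨f', ?_⟩
    rw [← hab]
    simpa using ha
  have hiter : ∀ k : ℕ, ∃ f', evalVec z h - π ^ k • evalVec z f' ∈ S := by
    intro k
    induction k with
    | zero => exact ⟨h, by simp⟩
    | succ k ih =>
      obtain ⟨f', hf'⟩ := ih
      obtain ⟨f'', hf''⟩ := hstep f'
      refine ⟨f'', ?_⟩
      have := S.add_mem hf' (S.smul_mem (π ^ k) hf'')
      rwa [smul_sub, sub_add_sub_cancel, smul_smul, ← pow_succ] at this
  obtain ⟨f', hf'⟩ := hiter N
  rwa [hπ, zero_smul, sub_zero] at hf'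

/-- A determinant whose rows lie in the span of a family vanishes if the determinants formed by
distinct members of the family vanish. -/
theorem Matrix.det_eq_zero_of_mem_span {n ι R : Type*} [Fintype n] [DecidableEq n] [CommRing R]
    (u : ι → n → R) (hu : ∀ φ : n → ι, Function.Injective φ → (Matrix.of fun j => u (φ j)).det = 0)
    (v : Matrix n n R) (hv : ∀ j, v j ∈ Submodule.span R (Set.range u)) : v.det = 0 := by
  classical
  choose c hc using fun j => (Finsupp.mem_span_range_iff_exists_finsupp).1 (hv j)
  have hv' : v = fun j => ∑ γ ∈ (c j).support, c j γ • u γ := by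
    funext j; exact (hc j).symm
  change (Matrix.detRowAlternating (n := n) (R := R)).toMultilinearMap v = 0
  rw [hv', MultilinearMap.map_sum_finset]
  refine Finset.sum_eq_zero fun φ _ => ?_
  rw [MultilinearMap.map_smul_univ (Matrix.detRowAlternating (n := n) (R := R)).toMultilinearMap
    (fun j => c j (φ j)) (fun j => u (φ j))]
  by_cases hφ : Function.Injective φ
  · have : (Matrix.detRowAlternating (n := n) (R := R)).toMultilinearMap (fun j => u (φ j)) = 0 :=
      hu φ hφ
    rw [this, smul_zero]
  · have : (Matrix.detRowAlternating (n := n) (R := R)).toMultilinearMap (fun j => u (φ j)) = 0 :=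
      AlternatingMap.map_eq_zero_of_not_injective _ _
        fun hinj => hφ fun a b hab => hinj (by simp [hab])
    rw [this, smul_zero]

/-- The determinant of the values of polynomials at points of a hypersurface that are congruent to
the origin modulo `π` is divisible by a high power of `π`. -/
theorem det_eval_eq_zero {n σ R : Type*} [Fintype n] [DecidableEq n] [Fintype σ] [CommRing R]
    (mo : MonomialOrder σ) (π : R) (N : ℕ) (hπ : π ^ N = 0) (t : n → σ → R)
    (g : MvPolynomial σ R) (β : σ →₀ ℕ)
    (hg : ∀ l, eval (fun i => π * t l i) g = 0) (hβ : IsUnit (coeff β g))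
    (hlow : ∀ γ, mo.toSyn γ < mo.toSyn β → π ∣ coeff γ g)
    (hN : ∀ φ : n → σ →₀ ℕ, Function.Injective φ → (∀ j, ¬ β ≤ φ j) → N ≤ ∑ j, (φ j).degree)
    (h : n → MvPolynomial σ R) :
    (Matrix.of fun j l => eval (fun i => π * t l i) (h j)).det = 0 := by
  refine Matrix.det_eq_zero_of_mem_span
    (fun γ : {γ : σ →₀ ℕ // ¬ β ≤ γ} => evalVec (fun l i => π * t l i) (monomial γ.1 1)) ?_ _ ?_
  · intro φ hφ
    have key : (Matrix.of fun j => evalVec (fun l i => π * t l i) (monomial (φ j).1 1)) =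
        Matrix.of fun j l => π ^ (φ j).1.degree *
          (Matrix.of (fun j l => eval (t l) (monomial (φ j).1 (1 : R))) : Matrix n n R) j l := by
      ext j l
      simp only [Matrix.of_apply, evalVec_apply, eval_monomial_mul]
    rw [key, Matrix.det_mul_column, Finset.prod_pow_eq_pow_sum,
      pow_eq_zero_of_le (hN (fun j => (φ j).1) (Subtype.val_injective.comp hφ)
        fun j => (φ j).2) hπ, zero_mul]
  · intro j
    have : (Matrix.of fun j l => eval (fun i => π * t l i) (h j)) j =
        evalVec (fun l i => π * t l i) (h j) := by
      funext l; simp [evalVec_apply]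
    rw [this]
    exact evalVec_mem_span mo π N hπ t g β hg hβ hlow (h j)

/-! ### Counting monomials and summing their degrees -/

/-- The prescribed `i`-th exponent carries no information, so it may be replaced by the slack that
makes the degree exactly `k`. This is injective into the monomials of degree `k` in `r + 1`
variables. -/
theorem card_degree_le_and_apply_eq {σ : Type*} [Fintype σ] [DecidableEq σ] {r : ℕ}
    (hσ : Fintype.card σ = r + 1) (k : ℕ) (i : σ) (v : ℕ) (T : Finset (σ →₀ ℕ))
    (hT : ∀ γ ∈ T, γ.degree ≤ k ∧ γ i = v) : T.card ≤ (k + r).choose r := by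
  have hcard : (Finset.finsuppAntidiag (Finset.univ : Finset σ) k).card = (k + r).choose r := by
    rw [Finset.card_finsuppAntidiag_nat_eq_choose, Finset.card_univ, hσ,
      show r + 1 + k - 1 = k + r by omega, Nat.choose_symm_add]
  rw [← hcard]
  have hsum : ∀ γ : σ →₀ ℕ, γ.degree = γ i + ∑ j ∈ Finset.univ.erase i, γ j := by
    intro γ
    rw [Finsupp.degree_eq_sum, Finset.add_sum_erase _ _ (Finset.mem_univ i)]
  refine Finset.card_le_card_of_injOn
    (fun γ => γ.update i (k - ∑ j ∈ Finset.univ.erase i, γ j)) ?_ ?_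
  · intro γ hγ
    have h1 := (hT γ hγ).1
    rw [hsum] at h1
    simp only [Finset.mem_coe, Finset.mem_finsuppAntidiag, Finset.subset_univ, and_true]
    rw [← Finset.add_sum_erase _ _ (Finset.mem_univ i)]
    have : ∑ j ∈ Finset.univ.erase i, (γ.update i (k - ∑ j ∈ Finset.univ.erase i, γ j)) j =
        ∑ j ∈ Finset.univ.erase i, γ j := by
      refine Finset.sum_congr rfl fun j hj => ?_
      rw [Finsupp.coe_update, Function.update_of_ne (Finset.ne_of_mem_erase hj)]
    rw [this, Finsupp.coe_update, Function.update_self]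
    omega
  · intro γ hγ γ' hγ' heq
    ext j
    by_cases hj : j = i
    · rw [hj, (hT γ hγ).2, (hT γ' hγ').2]
    · have := DFunLike.congr_fun heq j
      simpa [Finsupp.coe_update, Function.update_of_ne hj] using this

/-- The number of monomials of degree at most `k` in `r + 1` variables that are not multiples of a
given one. -/
theorem card_not_le_degree_le {σ : Type*} [Fintype σ] {r : ℕ}
    (hσ : Fintype.card σ = r + 1) (k : ℕ) (β : σ →₀ ℕ) (T : Finset (σ →₀ ℕ))
    (hT : ∀ γ ∈ T, γ.degree ≤ k ∧ ¬ β ≤ γ) : T.card ≤ β.degree * (k + r).choose r := by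
  classical
  -- A monomial that is not a multiple of `β` has some exponent `γ i = v` with `v < β i`, and there
  -- are `β.degree` such pairs `(i, v)`.
  have hsub : T ⊆ (Finset.univ.sigma fun i : σ => Finset.range (β i)).biUnion
      fun q => T.filter fun γ => γ q.1 = q.2 := by
    intro γ hγ
    have := (hT γ hγ).2
    rw [Finsupp.le_def] at this
    push Not at this
    obtain ⟨i, hi⟩ := this
    simp only [Finset.mem_biUnion, Finset.mem_sigma, Finset.mem_filter]
    exact ⟨⟨i, γ i⟩, ⟨Finset.mem_univ _, Finset.mem_range.2 hi⟩, hγ, rfl⟩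
  refine (Finset.card_le_card hsub).trans ((Finset.card_biUnion_le_card_mul _ _ ((k + r).choose r) ?_).trans ?_)
  · intro q _
    refine card_degree_le_and_apply_eq hσ k q.1 q.2 _ fun γ hγ => ?_
    rw [Finset.mem_filter] at hγ
    exact ⟨(hT γ hγ.1).1, hγ.2⟩
  · rw [Finset.card_sigma, Finsupp.degree_eq_sum]
    simp

/-- The tangent line of `x ^ (1 + 1 / r)` at `s + 1`. -/
theorem rpow_one_add_inv_step (r : ℕ) (hr : 1 ≤ r) (s : ℕ) :
    (r : ℝ) / (r + 1) * ((s + 1 : ℕ) : ℝ) ^ (1 + 1 / (r : ℝ)) ≤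
      (r : ℝ) / (r + 1) * (s : ℝ) ^ (1 + 1 / (r : ℝ)) + ((s + 1 : ℕ) : ℝ) ^ (1 / (r : ℝ)) := by
  have hr0 : (0 : ℝ) < r := by exact_mod_cast hr
  set q : ℝ := 1 / (r : ℝ) with hq
  have hq0 : 0 < q := by positivity
  set x : ℝ := ((s + 1 : ℕ) : ℝ) with hx
  have hx0 : 0 < x := by positivity
  have hs : (s : ℝ) = x * (1 + -1 / x) := by
    rw [hx]; field_simp; push_cast; ring
  have hx1 : -1 ≤ -1 / x := by
    rw [le_div_iff₀ hx0]
    have : (1 : ℝ) ≤ x := by rw [hx]; push_cast; linarith [Nat.cast_nonneg (α := ℝ) s]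
    linarith
  have hb := one_add_mul_self_le_rpow_one_add hx1 (p := 1 + q) (by linarith)
  have h1 : (s : ℝ) ^ (1 + q) = x ^ (1 + q) * (1 + -1 / x) ^ (1 + q) := by
    rw [hs, Real.mul_rpow hx0.le (by linarith)]
  have h2 : x ^ (1 + q) = x * x ^ q := by rw [Real.rpow_add hx0, Real.rpow_one]
  have h3 : x ^ (1 + q) - (1 + q) * x ^ q ≤ (s : ℝ) ^ (1 + q) := by
    rw [h1]
    have := mul_le_mul_of_nonneg_left hb (Real.rpow_nonneg hx0.le (1 + q))
    refine le_trans (le_of_eq ?_) this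
    rw [h2]; field_simp; ring
  have h4 : (r : ℝ) / (r + 1) * (1 + q) = 1 := by rw [hq]; field_simp
  have h5 := mul_le_mul_of_nonneg_left h3 (a := (r : ℝ) / (r + 1)) (by positivity)
  have h6 : (r : ℝ) / (r + 1) * (x ^ (1 + q) - (1 + q) * x ^ q) =
      (r : ℝ) / (r + 1) * x ^ (1 + q) - x ^ q := by
    rw [mul_sub, ← mul_assoc, h4, one_mul]
  linarith

/-- If a set of weights has at most `B * (k + r) ^ r` members of weight at most `k`, then the sum of
`s` of the weights grows at least like `s ^ (1 + 1 / r)`. -/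
theorem sum_lower_bound {ι : Type*} [DecidableEq ι] (r : ℕ) (hr : 1 ≤ r) (B : ℝ) (hB : 0 < B)
    (f : ι → ℕ) (T : Finset ι)
    (hT : ∀ k, ((T.filter fun i => f i ≤ k).card : ℝ) ≤ B * ((k : ℝ) + r) ^ r) :
    (1 / B) ^ (1 / (r : ℝ)) * ((r : ℝ) / (r + 1)) * (T.card : ℝ) ^ (1 + 1 / (r : ℝ)) - r * T.card ≤
      ((∑ i ∈ T, f i : ℕ) : ℝ) := by
  have hr0 : (0 : ℝ) < r := by exact_mod_cast hr
  induction hs : T.card generalizing T with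
  | zero =>
    have : (0 : ℝ) ^ (1 + 1 / (r : ℝ)) = 0 := Real.zero_rpow (by positivity)
    simp only [Nat.cast_zero, this]
    simp only [mul_zero, sub_zero]
    positivity
  | succ s ih =>
    -- All `s + 1` weights are at most the largest one, so the counting hypothesis at `k = f i`
    -- bounds `f i` from below. Removing `i` leaves a set to which induction applies.
    obtain ⟨i, hi, hmax⟩ := T.exists_max_image f (Finset.card_pos.1 (by omega))
    have ih' := ih (T.erase i) (fun k => le_trans (by
      exact_mod_cast Finset.card_le_card
        (Finset.filter_subset_filter _ (Finset.erase_subset _ _))) (hT k))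
      (by rw [Finset.card_erase_of_mem hi]; omega)
    have hall := hT (f i)
    rw [Finset.filter_true_of_mem hmax, hs] at hall
    have hfi : (1 / B) ^ (1 / (r : ℝ)) * ((s + 1 : ℕ) : ℝ) ^ (1 / (r : ℝ)) ≤ f i + r := by
      rw [← Real.mul_rpow (by positivity) (by positivity)]
      have h1 : 1 / B * ((s + 1 : ℕ) : ℝ) ≤ ((f i : ℝ) + r) ^ r := by
        rw [one_div_mul_eq_div, div_le_iff₀ hB, mul_comm]; exact hall
      refine (Real.rpow_le_rpow (by positivity) h1 (by positivity)).trans (le_of_eq ?_)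
      rw [one_div, Real.pow_rpow_inv_natCast (by positivity) (by omega)]
    rw [← Finset.add_sum_erase _ _ hi, Nat.cast_add (f i)]
    have hstep := mul_le_mul_of_nonneg_left (rpow_one_add_inv_step r hr s)
      (a := (1 / B) ^ (1 / (r : ℝ))) (by positivity)
    rw [mul_add] at hstep
    have hcast : ((s + 1 : ℕ) : ℝ) = s + 1 := by push_cast; ring
    have : (r : ℝ) * ((s + 1 : ℕ) : ℝ) = r * s + r := by rw [hcast]; ring
    rw [this]
    simp only [← mul_assoc] at hstep
    linarith

/-- The sum of the degrees of `s` distinct monomials in `r + 1` variables, none of them a multiple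
of a given monomial of degree `m`. -/
theorem sum_degree_lower_bound {σ : Type*} [Fintype σ] (r : ℕ) (hr : 1 ≤ r)
    (hσ : Fintype.card σ = r + 1) (β : σ →₀ ℕ) (hβ : 0 < β.degree) {s : ℕ}
    (φ : Fin s → σ →₀ ℕ) (hφ : Function.Injective φ) (hle : ∀ j, ¬ β ≤ φ j) :
    ((r.factorial : ℝ) / β.degree) ^ (1 / (r : ℝ)) * ((r : ℝ) / (r + 1)) *
      (s : ℝ) ^ (1 + 1 / (r : ℝ)) - r * s ≤ ((∑ j, (φ j).degree : ℕ) : ℝ) := by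
  classical
  have hβ' : (0 : ℝ) < β.degree := by exact_mod_cast hβ
  have hfac : (0 : ℝ) < r.factorial := by exact_mod_cast r.factorial_pos
  have := sum_lower_bound r hr ((β.degree : ℝ) / r.factorial) (by positivity)
    (fun j => (φ j).degree) (Finset.univ : Finset (Fin s)) ?_
  · simpa only [one_div_div, Finset.card_univ, Fintype.card_fin] using this
  · intro k
    have h1 := card_not_le_degree_le hσ k β
      ((Finset.univ.filter fun j => (φ j).degree ≤ k).image φ) (by
        intro γ hγ
        obtain ⟨j, hj, rfl⟩ := Finset.mem_image.1 hγ
        exact ⟨(Finset.mem_filter.1 hj).2, hle j⟩)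
    rw [Finset.card_image_of_injective _ hφ] at h1
    have h2 := Nat.choose_le_pow_div (α := ℝ) r (k + r)
    have h3 : ((Finset.univ.filter fun j => (φ j).degree ≤ k).card : ℝ) ≤
        β.degree * ((k + r).choose r : ℝ) := by exact_mod_cast h1
    refine h3.trans ((mul_le_mul_of_nonneg_left h2 hβ'.le).trans (le_of_eq ?_))
    push_cast; ring

/-! ### The local equation in a chart -/

open Classical in
/-- The equation of `F = 0` in the chart `x i = 1`, in the coordinates centred at the point `a`. -/
noncomputable def localEquation {ι A : Type*} [CommRing A] (i : ι) (a : ι → A) :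
    MvPolynomial ι A →ₐ[A] MvPolynomial {j : ι // j ≠ i} A :=
  aeval fun j => if h : j = i then 1 else X ⟨j, h⟩ + C (a j)

theorem eval_localEquation {ι A : Type*} [CommRing A] (i : ι) (a x : ι → A) (hx : x i = 1)
    (F : MvPolynomial ι A) :
    eval (fun j : {j : ι // j ≠ i} => x j - a j) (localEquation i a F) = eval x F := by
  have : (aeval fun j : {j : ι // j ≠ i} => x j - a j).comp (localEquation i a) =
      aeval (R := A) x := by
    refine algHom_ext fun j => ?_
    by_cases h : j = i
    · subst h; simp [localEquation, hx]
    · simp [localEquation, h]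
  simpa [aeval_eq_eval] using DFunLike.congr_fun this F

theorem map_localEquation {ι A B : Type*} [CommRing A] [CommRing B] (f : A →+* B) (i : ι)
    (a : ι → A) (F : MvPolynomial ι A) :
    map f (localEquation i a F) = localEquation i (fun j => f (a j)) (map f F) := by
  have : (map f).comp (localEquation i a).toRingHom =
      (localEquation i (fun j => f (a j))).toRingHom.comp (map f) := by
    refine ringHom_ext (fun c => ?_) fun j => ?_
    · simp [localEquation, algebraMap_eq]
    · by_cases h : j = i <;> simp [localEquation, h]
  exact DFunLike.congr_fun this F

theorem pderiv_localEquation {ι A : Type*} [CommRing A] (i : ι) (a : ι → A)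
    (j : {j : ι // j ≠ i}) (F : MvPolynomial ι A) :
    pderiv j (localEquation i a F) = localEquation i a (pderiv j.1 F) := by
  classical
  induction F using MvPolynomial.induction_on with
  | C c => simp [localEquation, algebraMap_eq]
  | add p q hp hq => simp only [map_add, hp, hq]
  | mul_X p l hp =>
    have hX : pderiv j (localEquation i a (X l)) = localEquation i a (pderiv j.1 (X l)) := by
      by_cases h : l = i
      · subst h
        rw [pderiv_X_of_ne j.2.symm]
        simp [localEquation]
      · simp only [localEquation, aeval_X, h, dite_false, map_add, pderiv_C, add_zero, pderiv_X]
        by_cases hl : l = j.1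
        · have : (⟨l, h⟩ : {j : ι // j ≠ i}) = j := Subtype.ext hl
          simp [hl]
        · have : (⟨l, h⟩ : {j : ι // j ≠ i}) ≠ j := fun e => hl (congrArg Subtype.val e)
          rw [Pi.single_eq_of_ne' this.symm, Pi.single_eq_of_ne' (Ne.symm hl), map_zero]
    rw [map_mul, pderiv_mul, hp, hX, pderiv_mul, map_add, map_mul, map_mul]

/-- Evaluation of a weighted homogeneous polynomial is compatible with weighted scaling. -/
theorem MvPolynomial.IsWeightedHomogeneous.aeval_pow_mul {ι A B : Type*} [CommRing A] [CommRing B]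
    [Algebra A B] {w : ι → ℕ} {d : ℕ} {F : MvPolynomial ι A} (hF : IsWeightedHomogeneous w F d)
    (c : B) (x : ι → B) : aeval (fun j => c ^ w j * x j) F = c ^ d * aeval x F := by
  induction hF using IsWeightedHomogeneous.induction_on with
  | zero => simp
  | add p q hp hq ihp ihq => rw [map_add, map_add, ihp, ihq, mul_add]
  | monomial m r hm =>
    simp only [aeval_monomial, mul_pow, Finsupp.prod, Finset.prod_mul_distrib, ← pow_mul]
    rw [Finset.prod_pow_eq_pow_sum, ← hm, Finsupp.weight_apply, Finsupp.sum]
    simp only [smul_eq_mul, mul_comm (m _) (w _)]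
    ring

theorem MvPolynomial.IsWeightedHomogeneous.map_ringHom {ι A B : Type*} [CommRing A] [CommRing B]
    {w : ι → ℕ} {d : ℕ} {F : MvPolynomial ι A} (hF : IsWeightedHomogeneous w F d) (f : A →+* B) :
    IsWeightedHomogeneous w (map f F) d := by
  intro m hm
  refine hF fun h => hm ?_
  rw [coeff_map, h, map_zero]

/-- The chart contains the generic point of the weighted space: dividing the generic coordinates by
the powers `y i ^ w j` makes the `i`-th one equal to one, since `w i = 1`. By homogeneity `F`
changes there only by a nonzero factor. -/
theorem localEquation_ne_zero {ι k : Type*} [Field k] {w : ι → ℕ} {d : ℕ} {F : MvPolynomial ι k}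
    (hF : IsWeightedHomogeneous w F d) (hF0 : F ≠ 0) {i : ι} (hi : w i = 1) (a : ι → k) :
    localEquation i a F ≠ 0 := by
  classical
  intro h0
  let K := FractionRing (MvPolynomial ι k)
  let y : ι → K := fun j => algebraMap (MvPolynomial ι k) K (X j)
  have hyi : y i ≠ 0 := by
    simp only [y, ne_eq, FaithfulSMul.algebraMap_eq_zero_iff]
    exact X_ne_zero i
  let x : ι → K := fun j => (y i)⁻¹ ^ w j * y j
  have hcomp : (aeval (R := k) fun j : {j : ι // j ≠ i} => x j - algebraMap k K (a j)).comp
      (localEquation i a) = aeval (R := k) x := by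
    refine algHom_ext fun j => ?_
    by_cases h : j = i
    · subst h; simp [localEquation, x, hi, hyi]
    · simp [localEquation, h]
  have hx : aeval x F = 0 := by
    rw [← hcomp, AlgHom.comp_apply, h0, map_zero]
  rw [hF.aeval_pow_mul] at hx
  have hy : aeval y F = 0 := (mul_eq_zero.1 hx).resolve_left (pow_ne_zero _ (inv_ne_zero hyi))
  have hmap : aeval y F = algebraMap (MvPolynomial ι k) K F := by
    have := (aeval_algebraMap_apply K (X : ι → MvPolynomial ι k) F)
    rwa [aeval_X_left_apply] at this
  rw [hmap, FaithfulSMul.algebraMap_eq_zero_iff] at hy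
  exact hF0 hy

/-! ### Coordinate vectors and multiplicity -/

namespace WeightedProjectiveSpace

variable {ι : Type*} {w : ι → ℕ} {k : Type*} [Field k]

theorem IsRep.exists_unit {P : WeightedProjectiveSpace w k} {x y : ι → k} (hx : P.IsRep x)
    (hy : P.IsRep y) : ∃ c : kˣ, ∀ i, x i = (c : k) ^ w i * y i := by
  obtain ⟨hx0, hx⟩ := hx
  obtain ⟨hy0, hy⟩ := hy
  exact Quotient.exact (hx.trans hy.symm)

theorem IsRep.scale {P : WeightedProjectiveSpace w k} {x : ι → k} (hx : P.IsRep x) (c : kˣ) :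
    P.IsRep fun i => (c : k) ^ w i * x i := by
  obtain ⟨hx0, hx⟩ := hx
  have h0 : (fun i => (c : k) ^ w i * x i) ≠ 0 := by
    intro h
    apply hx0
    funext i
    have := congrFun h i
    simpa using this
  refine ⟨h0, Eq.trans (Quotient.sound ?_) hx⟩
  exact ⟨c, fun i => rfl⟩

/-- A coordinate vector of a point is determined by a coordinate of weight one that equals one. -/
theorem IsRep.eq_of_apply_eq_one {P : WeightedProjectiveSpace w k} {x y : ι → k} (hx : P.IsRep x)
    (hy : P.IsRep y) {i : ι} (hi : w i = 1) (hxi : x i = 1) (hyi : y i = 1) : x = y := by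
  obtain ⟨c, hc⟩ := hx.exists_unit hy
  have h1 : (c : k) = 1 := by
    have := hc i
    rw [hi, hxi, hyi, pow_one, mul_one] at this
    exact this.symm
  funext j
  rw [hc j, h1, one_pow, one_mul]

theorem dehomogenize_eq_localEquation (i : ι) (F : MvPolynomial ι k) :
    dehomogenize i F = localEquation i 0 F := by
  simp only [dehomogenize, localEquation]
  congr 2
  funext j
  by_cases h : j = i <;> simp [h]

theorem localEquation_eq_aeval_dehomogenize (i : ι) (a : ι → k) (F : MvPolynomial ι k) :
    localEquation i a F =
      aeval (fun j : {j : ι // j ≠ i} => X j + C (a j)) (dehomogenize i F) := by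
  have : localEquation i a = (aeval fun j : {j : ι // j ≠ i} => X j + C (a j)).comp
      (localEquation i 0) := by
    refine algHom_ext fun j => ?_
    by_cases h : j = i <;> simp [localEquation, h]
  rw [this, AlgHom.comp_apply, dehomogenize_eq_localEquation]

theorem map_translate_pointIdeal_le {σ : Type*} (a : σ → k) :
    (pointIdeal a).map (aeval (R := k) fun j => X j + C (a j)) ≤ idealOfVars σ k := by
  rw [Ideal.map_le_iff_le_comap]
  intro f hf
  rw [pointIdeal, RingHom.mem_ker] at hf
  rw [Ideal.mem_comap, ← pow_one (idealOfVars σ k), mem_pow_idealOfVars_iff']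
  intro m hm
  rw [Nat.lt_one_iff, Finsupp.degree_eq_zero_iff] at hm
  subst hm
  have : (aeval (0 : σ → k)).comp (aeval (R := k) fun j => X j + C (a j)) = aeval (R := k) a := by
    refine algHom_ext fun j => ?_
    simp
  have h := DFunLike.congr_fun this f
  rw [AlgHom.comp_apply, aeval_eq_eval, aeval_eq_eval] at h
  rw [← constantCoeff_eq, ← eval_zero]
  exact h.trans hf

theorem map_translate_idealOfVars_le {σ : Type*} (a : σ → k) :
    (idealOfVars σ k).map (aeval (R := k) fun j => X j - C (a j)) ≤ pointIdeal a := by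
  rw [idealOfVars, Ideal.map_span, Ideal.span_le]
  rintro _ ⟨_, ⟨j, rfl⟩, rfl⟩
  simp [pointIdeal, RingHom.mem_ker]

/-- Translation by `x` is an automorphism that exchanges the maximal ideals of the point and of the
origin. Membership in a power thereby becomes the vanishing of the coefficients of low degree. -/
theorem dehomogenize_mem_pointIdeal_pow_iff (i : ι) (x : ι → k) (F : MvPolynomial ι k) (n : ℕ) :
    dehomogenize i F ∈ pointIdeal (fun j : {j : ι // j ≠ i} => x j) ^ n ↔
      localEquation i x F ∈ idealOfVars {j : ι // j ≠ i} k ^ n := by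
  constructor
  · intro h
    have h1 := Ideal.mem_map_of_mem (aeval (R := k) fun j : {j : ι // j ≠ i} => X j + C (x j)) h
    rw [Ideal.map_pow] at h1
    rw [localEquation_eq_aeval_dehomogenize]
    exact Ideal.pow_right_mono (map_translate_pointIdeal_le _) n h1
  · intro h
    have h1 := Ideal.mem_map_of_mem (aeval (R := k) fun j : {j : ι // j ≠ i} => X j - C (x j)) h
    rw [Ideal.map_pow] at h1
    have h2 : dehomogenize i F =
        aeval (fun j : {j : ι // j ≠ i} => X j - C (x j)) (localEquation i x F) := by
      rw [localEquation_eq_aeval_dehomogenize]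
      have : (aeval (fun j : {j : ι // j ≠ i} => X j - C (x j))).comp
          (aeval (R := k) fun j : {j : ι // j ≠ i} => X j + C (x j)) = AlgHom.id k _ := by
        refine algHom_ext fun j => ?_
        simp [algebraMap_eq]
      exact (DFunLike.congr_fun this _).symm
    rw [h2]
    exact Ideal.pow_right_mono (map_translate_idealOfVars_le _) n h1

/-- The multiplicity is at least the order of the local equation in any chart. -/
theorem le_multiplicity [Finite ι] [Finite k] {d : ℕ} {F : MvPolynomial ι k}
    (hF : IsWeightedHomogeneous w F d) (hF0 : F ≠ 0) {P : WeightedProjectiveSpace w k}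
    {i : ι} {x : ι → k} (hi : w i = 1) (hxi : x i = 1) (hx : P.IsRep x) {m : ℕ}
    (hm : ∀ γ : {j : ι // j ≠ i} →₀ ℕ, γ.degree < m → coeff γ (localEquation i x F) = 0) :
    m ≤ P.multiplicity F := by
  refine le_csSup ?_ ⟨i, x, hi, hxi, hx,
    (dehomogenize_mem_pointIdeal_pow_iff i x F m).2 ((mem_pow_idealOfVars_iff' _ _).2 hm)⟩
  -- The supremum is meaningful only for a bounded set. There are finitely many charts and vectors
  -- over a finite field, and the order of a nonzero polynomial is at most its total degree.
  obtain ⟨D, hD⟩ := (Set.finite_range fun q : ι × (ι → k) =>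
    (localEquation q.1 q.2 F).totalDegree).bddAbove
  refine ⟨D, ?_⟩
  rintro n ⟨i', x', hi', -, -, hn⟩
  rw [dehomogenize_mem_pointIdeal_pow_iff, mem_pow_idealOfVars_iff'] at hn
  obtain ⟨γ, hγ⟩ := ne_zero_iff.1 (localEquation_ne_zero hF hF0 hi' x')
  exact (not_lt.1 fun h => hγ (hn γ h)).trans
    ((le_totalDegree (mem_support_iff.2 hγ)).trans (hD ⟨(i', x'), rfl⟩))

end WeightedProjectiveSpace

/-! ### Nonsingular points -/

/-- For a weighted homogeneous form the nonsingularity of a zero can be tested in a given chart. -/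
theorem exists_pderiv_ne_zero {ι k : Type*} [Fintype ι] [Field k] {w : ι → ℕ} {d : ℕ}
    {F : MvPolynomial ι k} (hF : IsWeightedHomogeneous w F d) {x : ι → k} (hx : eval x F = 0)
    {i : ι} (hi : w i = 1) (hxi : x i = 1) (hns : ∃ j, eval x (pderiv j F) ≠ 0) :
    ∃ j, j ≠ i ∧ eval x (pderiv j F) ≠ 0 := by
  classical
  by_contra! hcon
  obtain ⟨j, hj⟩ := hns
  have hji : j = i := by_contra fun h => hj (hcon j h)
  subst hji
  -- Weighted Euler relation: at a zero of `F` it reduces to `w i * x i * ∂F/∂x i = 0`, where `w i =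
  -- x i = 1`.
  have he := congrArg (eval x) hF.sum_weight_X_mul_pderiv
  rw [map_sum, map_nsmul, hx, smul_zero, Finset.sum_eq_single j] at he
  · apply hj
    simpa [hi, hxi] using he
  · intro l _ hl
    simp [hcon l hl]
  · simp

/-- The partial derivatives at two coordinate vectors of a point vanish simultaneously. -/
theorem eval_pderiv_scale {ι k : Type*} [Field k] {w : ι → ℕ} {d : ℕ}
    {F : MvPolynomial ι k} (hF : IsWeightedHomogeneous w F d) (c : kˣ) (x : ι → k) (j : ι)
    (h : eval x (pderiv j F) ≠ 0) : eval (fun l => (c : k) ^ w l * x l) (pderiv j F) ≠ 0 := by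
  by_cases hd : w j ≤ d
  · have := (hF.pderiv (i := j) (Nat.sub_add_cancel hd)).aeval_pow_mul (c : k) x
    rw [aeval_eq_eval, aeval_eq_eval] at this
    change eval _ _ = _ * eval _ _ at this
    rw [this]
    exact mul_ne_zero (pow_ne_zero _ c.ne_zero) h
  · exfalso
    apply h
    -- A variable of weight greater than `d` cannot occur in `F`.
    have h0 : pderiv j F = 0 := by
      refine pderiv_eq_zero_of_notMem_vars fun hj => hd ?_
      obtain ⟨m, hm, hjm⟩ := mem_vars_iff_mem_support j |>.1 hj
      have := hF (mem_support_iff.1 hm)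
      rw [← this]
      exact Finsupp.le_weight_of_ne_zero' w (Finsupp.mem_support_iff.1 hjm)
    rw [h0, map_zero]

namespace WeightedProjectiveSpace

/-- At a nonsingular point some linear coefficient of the local equation does not vanish. -/
theorem IsNonsingular.exists_coeff_ne_zero {ι k : Type*} [Fintype ι] [Field k] {w : ι → ℕ} {d : ℕ}
    {F : MvPolynomial ι k} (hF : IsWeightedHomogeneous w F d) {P : WeightedProjectiveSpace w k}
    (hP : P ∈ zeroLocus w F) (hns : P.IsNonsingular F) {i : ι} {x : ι → k} (hi : w i = 1)
    (hxi : x i = 1) (hx : P.IsRep x) :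
    ∃ j : {j : ι // j ≠ i}, coeff (Finsupp.single j 1) (localEquation i x F) ≠ 0 := by
  obtain ⟨i', y, -, hyi, hy, -, j', hj'⟩ := hns
  have hj'' : eval y (pderiv j'.1 F) ≠ 0 := by
    rw [← eval_localEquation i' 0 y hyi]
    simpa [dehomogenize_eq_localEquation, pderiv_localEquation] using hj'
  obtain ⟨c, hc⟩ := hx.exists_unit hy
  have hxc : x = fun l => (c : k) ^ w l * y l := funext hc
  obtain ⟨j, hji, hj⟩ := exists_pderiv_ne_zero hF (hP x hx) hi hxi
    ⟨j'.1, by rw [hxc]; exact eval_pderiv_scale hF c y _ hj''⟩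
  refine ⟨⟨j, hji⟩, fun h0 => hj ?_⟩
  have h1 : coeff 0 (pderiv (⟨j, hji⟩ : {j : ι // j ≠ i}) (localEquation i x F)) = 0 := by
    rw [coeff_pderiv, zero_add, h0, zero_mul]
  rw [pderiv_localEquation, ← constantCoeff_eq, ← eval_zero] at h1
  rw [← eval_localEquation i x x hxi, ← h1]
  simp only [sub_self]
  rfl

end WeightedProjectiveSpace

/-! ### From integral points to the ring modulo `p ^ N` -/

theorem map_eval_intCast {ι A : Type*} [CommRing A] (x : ι → ℤ) (F : MvPolynomial ι ℤ) :
    eval (fun i => (x i : A)) (map (Int.castRingHom A) F) = ((eval x F : ℤ) : A) := by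
  rw [eval_map, ← eq_intCast (Int.castRingHom A)]
  exact (eval₂_comp_left (Int.castRingHom A) (RingHom.id ℤ) x F).symm

/-- Integral points whose reductions represent one point of a hypersurface over `𝔽_p` satisfy the
determinant divisibility dictated by the initial monomial of the local equation. -/
theorem pow_dvd_det_monomial {ι : Type*} [Fintype ι] [DecidableEq ι] {w : ι → ℕ} {p : ℕ}
    [Fact p.Prime] {F : MvPolynomial ι ℤ} {d : ℕ} (hF : IsWeightedHomogeneous w F d)
    {P : WeightedProjectiveSpace w (ZMod p)} {i : ι} (hi : w i = 1) (a : ι → ℤ)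
    (haP : P.IsRep fun j => (a j : ZMod p)) (hai : (a i : ZMod p) = 1) {s N u : ℕ}
    (ξ : Fin s → ι → ℤ) (hξF : ∀ l, eval (ξ l) F = 0) (hξi : ∀ l, (ξ l i : ZMod p) ≠ 0)
    (hξP : ∀ l, P.IsRep fun j => (ξ l j : ZMod p))
    (mo : MonomialOrder {j : ι // j ≠ i}) (β : {j : ι // j ≠ i} →₀ ℕ)
    (hβ : coeff β (localEquation i (fun j => (a j : ZMod p)) (reduceForm p F)) ≠ 0)
    (hlow : ∀ γ, mo.toSyn γ < mo.toSyn β →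
      coeff γ (localEquation i (fun j => (a j : ZMod p)) (reduceForm p F)) = 0)
    (hN : ∀ φ : Fin s → {j : ι // j ≠ i} →₀ ℕ, Function.Injective φ → (∀ j, ¬ β ≤ φ j) →
      N ≤ ∑ j, (φ j).degree)
    (α : Fin s → ι →₀ ℕ) (hα : ∀ j, Finsupp.weight w (α j) = u) :
    (p : ℤ) ^ N ∣ (Matrix.of fun j l : Fin s => eval (ξ l) (monomial (α j) (1 : ℤ))).det := by
  have hp : p.Prime := Fact.out
  have hpint : Prime (p : ℤ) := Nat.prime_iff_prime_int.1 hp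
  have hmod : ∀ c : ℤ, (c : ZMod p) = 0 ↔ (p : ℤ) ∣ c :=
    fun c => ZMod.intCast_zmod_eq_zero_iff_dvd c p
  have hcop : ∀ c : ℤ, ¬ (p : ℤ) ∣ c → ∀ n : ℕ, ∃ e : ℤ, (p : ℤ) ^ n ∣ e * c - 1 := by
    intro c hc n
    have h1 : IsCoprime c ((p : ℤ) ^ n) :=
      (((Prime.coprime_iff_not_dvd hpint).2 hc).symm).pow_right
    obtain ⟨e, f, hef⟩ := h1
    exact ⟨e, -f, by linear_combination hef⟩
  -- The exponent `N + 1` makes `e l` an inverse of `ξ l i` modulo `p` even if `N = 0`, as well as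
  -- modulo `p ^ N`.
  choose e he using fun l => hcop (ξ l i) (fun h => hξi l ((hmod _).2 h)) (N + 1)
  have he' : ∀ l, (e l : ZMod p) * (ξ l i : ZMod p) = 1 := by
    intro l
    have := (hmod _).2 ((dvd_pow_self (p : ℤ) N.succ_ne_zero).trans (he l))
    push_cast at this
    exact sub_eq_zero.1 this
  set y : Fin s → ι → ℤ := fun l j => e l ^ w j * ξ l j with hy
  have hyhom : ∀ (l : Fin s) {G : MvPolynomial ι ℤ} {n : ℕ}, IsWeightedHomogeneous w G n →
      eval (y l) G = e l ^ n * eval (ξ l) G := by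
    intro l G n hG
    have := hG.aeval_pow_mul (e l) (ξ l)
    rwa [aeval_eq_eval, aeval_eq_eval] at this
  have hya : ∀ l j, (p : ℤ) ∣ y l j - a j := by
    intro l j
    have hrep := (hξP l).scale (Units.mkOfMulEqOne _ _ (he' l))
    have := hrep.eq_of_apply_eq_one haP hi (by simpa [hi] using he' l) hai
    have hj := congrFun this j
    rw [← hmod, Int.cast_sub, sub_eq_zero, ← hj]
    simp [hy]
  choose t ht using hya
  obtain ⟨R, _, hcastR⟩ : ∃ (R : Type) (_ : CommRing R), ∀ c : ℤ, (c : R) = 0 ↔ (p : ℤ) ^ N ∣ c :=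
    ⟨ZMod (p ^ N), inferInstance, fun c => by
      rw [ZMod.intCast_zmod_eq_zero_iff_dvd, Nat.cast_pow]⟩
  have hπ : (p : R) ^ N = 0 := by
    have := (hcastR ((p : ℤ) ^ N)).2 dvd_rfl
    exact_mod_cast this
  have heR : ∀ l, (e l : R) * (ξ l i : R) = 1 := by
    intro l
    have := (hcastR _).2 ((pow_dvd_pow (p : ℤ) N.le_succ).trans (he l))
    push_cast at this
    exact sub_eq_zero.1 this
  have heval : ∀ (l : Fin s) (G : MvPolynomial ι ℤ),
      eval (fun j : {j : ι // j ≠ i} => (p : R) * (t l j : R))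
        (localEquation i (fun j => (a j : R)) (map (Int.castRingHom R) G)) =
      ((eval (y l) G : ℤ) : R) := by
    intro l G
    rw [← map_eval_intCast, ← eval_localEquation i (fun j => (a j : R)) (fun j => (y l j : R))
      (by simpa [hy, hi] using heR l)]
    congr 2
    funext j
    have := congrArg (Int.cast (R := R)) (ht l j)
    push_cast at this
    exact this.symm
  have hcoeff : ∀ γ, coeff γ (localEquation i (fun j => (a j : R)) (map (Int.castRingHom R) F)) =
      ((coeff γ (localEquation i a F) : ℤ) : R) := by
    intro γ
    have := map_localEquation (Int.castRingHom R) i a F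
    simp only [eq_intCast] at this
    rw [← this, coeff_map, eq_intCast]
  have hcoeffp : ∀ γ, coeff γ (localEquation i (fun j => (a j : ZMod p)) (reduceForm p F)) =
      ((coeff γ (localEquation i a F) : ℤ) : ZMod p) := by
    intro γ
    have := map_localEquation (Int.castRingHom (ZMod p)) i a F
    simp only [eq_intCast] at this
    rw [reduceForm, ← this, coeff_map, eq_intCast]
  have hdet := det_eval_eq_zero mo (p : R) N hπ (fun l j => (t l j.1 : R))
    (localEquation i (fun j => (a j : R)) (map (Int.castRingHom R) F)) β
    (fun l => by rw [heval, hyhom l hF, hξF, mul_zero, Int.cast_zero])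
    (by
      rw [hcoeffp, ne_eq, hmod] at hβ
      obtain ⟨f, hf⟩ := hcop _ hβ N
      have := (hcastR _).2 hf
      push_cast at this
      rw [hcoeff]
      exact IsUnit.of_mul_eq_one_right _ (sub_eq_zero.1 this))
    (fun γ hγ => by
      have := hlow γ hγ
      rw [hcoeffp, hmod] at this
      obtain ⟨c, hc⟩ := this
      rw [hcoeff, hc]
      exact ⟨(c : R), by push_cast; rfl⟩)
    hN (fun j => localEquation i (fun j => (a j : R))
      (map (Int.castRingHom R) (monomial (α j) 1)))
  -- All the monomials have weight `u`, so scaling the point `ξ l` multiplies its whole column by `e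
  -- l ^ u`, which is a unit modulo `p ^ N`.
  have hmat : (Matrix.of fun j l : Fin s => eval (fun i' => (p : R) * (t l i'.1 : R))
      (localEquation i (fun j => (a j : R)) (map (Int.castRingHom R) (monomial (α j) 1)))) =
      Matrix.of fun j l => (e l : R) ^ u *
        ((Matrix.of fun j l : Fin s => eval (ξ l) (monomial (α j) (1 : ℤ))).map
          (Int.cast : ℤ → R)) j l := by
    ext j l
    rw [Matrix.of_apply, heval,
      hyhom l (isWeightedHomogeneous_monomial w (α j) (1 : ℤ) (hα j))]
    simp
  rw [hmat, Matrix.det_mul_row] at hdet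
  have hunit : IsUnit (∏ l, (e l : R) ^ u) := by
    rw [IsUnit.prod_univ_iff]
    exact fun l => (IsUnit.of_mul_eq_one _ (heR l)).pow u
  rw [← hcastR, Int.cast_det]
  exact (hunit.mul_right_eq_zero).1 hdet

theorem reduceForm_ne_zero {ι : Type*} {p : ℕ} (hp : p.Prime) {F : MvPolynomial ι ℤ}
    (hF : IsPrimitiveForm F) : reduceForm p F ≠ 0 := by
  intro h
  refine (Nat.prime_iff_prime_int.1 hp).not_isUnit (hF p fun m => ?_)
  rw [← ZMod.intCast_zmod_eq_zero_iff_dvd, ← eq_intCast (Int.castRingHom (ZMod p)), ← coeff_map]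
  change coeff m (reduceForm p F) = 0
  rw [h, coeff_zero]

/-- A common chart of weight one for integral points that represent one point modulo `p`. -/
theorem exists_chart {r : ℕ} {w : Fin (r + 2) → ℕ} (h0 : w 0 = 1) (h1 : w 1 = 1) {p : ℕ}
    [Fact p.Prime] {P : WeightedProjectiveSpace w (ZMod p)} {s : ℕ} (hs : 0 < s)
    (ξ : Fin s → Fin (r + 2) → ℤ) (hgcd : ∀ l, Int.gcd (ξ l 0) (ξ l 1) = 1)
    (hP : ∀ l, P.IsRep fun i => (ξ l i : ZMod p)) :
    ∃ i, w i = 1 ∧ ∀ l, (ξ l i : ZMod p) ≠ 0 := by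
  obtain ⟨i, hi, hne⟩ : ∃ i, w i = 1 ∧ (ξ ⟨0, hs⟩ i : ZMod p) ≠ 0 := by
    -- Otherwise `p` would divide both of the coprime coordinates `ξ 0` and `ξ 1`.
    by_contra! h
    have h0' := h 0 h0
    have h1' := h 1 h1
    rw [ZMod.intCast_zmod_eq_zero_iff_dvd] at h0' h1'
    have := Int.dvd_coe_gcd h0' h1'
    rw [hgcd] at this
    exact (Nat.prime_iff_prime_int.1 (Fact.out : p.Prime)).not_isUnit (isUnit_of_dvd_one this)
  refine ⟨i, hi, fun l hl => hne ?_⟩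
  obtain ⟨c, hc⟩ := (hP ⟨0, hs⟩).exists_unit (hP l)
  rw [hc i, hl, mul_zero]

/-! ### Proof of the theorem -/

theorem theorem4p1 (r : ℕ) (hr : 1 ≤ r) :
    ∃ (κ : ℕ → ℝ) (κ' : ℝ), (∀ d, 0 < κ d) ∧ 0 < κ' ∧
      ∀ (d : ℕ) (w : Fin (r + 2) → ℕ), (∀ i, 0 < w i) → w 0 = 1 → w 1 = 1 →
      ∀ (p : ℕ) [Fact p.Prime] (F : MvPolynomial (Fin (r + 2)) ℤ),
        IsPrimitiveForm F → IsWeightedHomogeneous w F d →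
      ∀ P : WeightedProjectiveSpace w (ZMod p),
        P ∈ WeightedProjectiveSpace.zeroLocus w (reduceForm p F) →
      ∀ (s : ℕ), 0 < s →
      ∀ ξ : Fin s → Fin (r + 2) → ℤ, Function.Injective ξ →
        (∀ l, eval (ξ l) F = 0) →
        (∀ l, Int.gcd (ξ l 0) (ξ l 1) = 1) →
        (∀ l, P.IsRep (fun i => (ξ l i : ZMod p))) →
      ∀ (u : ℕ) (α : Fin s → Fin (r + 2) →₀ ℕ), (∀ j, Finsupp.weight w (α j) = u) →
      ∃ N : ℕ,
        (p : ℤ) ^ N ∣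
          (Matrix.of fun j l : Fin s => eval (ξ l) (monomial (α j) (1 : ℤ))).det ∧
        (N : ℝ) > ((r.factorial : ℝ) / (P.multiplicity (reduceForm p F) : ℝ)) ^ (1 / (r : ℝ)) *
            ((r : ℝ) / ((r : ℝ) + 1)) * (s : ℝ) ^ (1 + 1 / (r : ℝ)) - κ d * s ∧
        (P.IsNonsingular (reduceForm p F) →
          (N : ℝ) > (r.factorial : ℝ) ^ (1 / (r : ℝ)) *
            ((r : ℝ) / ((r : ℝ) + 1)) * (s : ℝ) ^ (1 + 1 / (r : ℝ)) - κ' * s) := by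
  classical
  -- The loss `r * s` comes from the shift in `(k + r) ^ r`; the additional `s > 0` makes the
  -- inequalities strict. No dependence on `d` is needed.
  refine ⟨fun _ => r + 1, r + 1, fun _ => by positivity, by positivity, ?_⟩
  intro d w _ hw0 hw1 p hpf F hprim hF P hP s hs ξ _ hξF hgcd hξP u α hα
  have hp : p.Prime := hpf.out
  obtain ⟨i, hi, hξi⟩ := exists_chart hw0 hw1 hs ξ hgcd hξP
  have hFp : IsWeightedHomogeneous w (reduceForm p F) d := hF.map_ringHom _
  have hFp0 : reduceForm p F ≠ 0 := reduceForm_ne_zero hp hprim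
  obtain ⟨a, haP, hai⟩ : ∃ a : Fin (r + 2) → ℤ, P.IsRep (fun j => (a j : ZMod p)) ∧
      (a i : ZMod p) = 1 := by
    have hrep := (hξP ⟨0, hs⟩).scale (Units.mk0 _ (hξi ⟨0, hs⟩))⁻¹
    choose a ha using fun j => ZMod.intCast_surjective
      (((Units.mk0 _ (hξi ⟨0, hs⟩))⁻¹ : (ZMod p)ˣ) ^ w j * (ξ ⟨0, hs⟩ j : ZMod p) : ZMod p)
    refine ⟨a, ?_, ?_⟩
    · simpa only [ha] using hrep
    · rw [ha, hi, pow_one, Units.val_inv_eq_inv_val, Units.val_mk0]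
      exact inv_mul_cancel₀ (hξi ⟨0, hs⟩)
  set g := localEquation i (fun j => (a j : ZMod p)) (reduceForm p F) with hg
  have hg0 : g ≠ 0 := localEquation_ne_zero hFp hFp0 hi _
  -- With a degree order, the least monomial of `g` also has least degree, so `β.degree` is the
  -- order of vanishing.
  let mo : MonomialOrder {j : Fin (r + 2) // j ≠ i} := MonomialOrder.degLex
  obtain ⟨β, hβmem, hβmin⟩ := g.support.exists_min_image mo.toSyn (support_nonempty.2 hg0)
  have hβ : coeff β g ≠ 0 := mem_support_iff.1 hβmem
  have hlow : ∀ γ, mo.toSyn γ < mo.toSyn β → coeff γ g = 0 := fun γ hγ =>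
    notMem_support_iff.1 fun h => (hβmin γ h).not_gt hγ
  have hlowdeg : ∀ γ : {j : Fin (r + 2) // j ≠ i} →₀ ℕ, γ.degree < β.degree → coeff γ g = 0 := by
    intro γ hγ
    refine notMem_support_iff.1 fun h => ?_
    exact hγ.not_ge
      (Finsupp.DegLex.monotone_degree (MonomialOrder.degLex_le_iff.1 (hβmin γ h)))
  have hβpos : 0 < β.degree := by
    rw [Nat.pos_iff_ne_zero, ne_eq, Finsupp.degree_eq_zero_iff]
    rintro rfl
    apply hβ
    -- The constant term of `g` is the value of the form at `a`, which is zero because `P` lies on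
    -- the hypersurface.
    have h0 := eval_localEquation i (fun j => (a j : ZMod p)) (fun j => (a j : ZMod p)) hai
      (reduceForm p F)
    rw [hP _ haP] at h0
    simp only [sub_self] at h0
    rw [← constantCoeff_eq, ← eval_zero]
    exact h0
  have hmult : β.degree ≤ P.multiplicity (reduceForm p F) :=
    WeightedProjectiveSpace.le_multiplicity hFp hFp0 hi hai haP hlowdeg
  have hcard : Fintype.card {j : Fin (r + 2) // j ≠ i} = r + 1 := by
    simp [Fintype.card_subtype_compl]
  set b : ℝ := ((r.factorial : ℝ) / β.degree) ^ (1 / (r : ℝ)) * ((r : ℝ) / (r + 1)) *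
      (s : ℝ) ^ (1 + 1 / (r : ℝ)) - r * s with hb
  have hbN : b ≤ ⌈b⌉₊ := Nat.le_ceil b
  have hs' : (0 : ℝ) < s := by exact_mod_cast hs
  refine ⟨⌈b⌉₊, ?_, ?_, fun hns => ?_⟩
  · refine pow_dvd_det_monomial hF hi a haP hai ξ hξF hξi hξP mo β hβ hlow ?_ α hα
    intro φ hφ hle
    exact Nat.ceil_le.2 (sum_degree_lower_bound r hr hcard β hβpos φ hφ hle)
  · have hβ' : (0 : ℝ) < β.degree := by exact_mod_cast hβpos
    have h1 : ((r.factorial : ℝ) / (P.multiplicity (reduceForm p F) : ℝ)) ^ (1 / (r : ℝ)) ≤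
        ((r.factorial : ℝ) / β.degree) ^ (1 / (r : ℝ)) := by
      refine Real.rpow_le_rpow (by positivity) ?_ (by positivity)
      exact div_le_div_of_nonneg_left (by positivity) hβ' (by exact_mod_cast hmult)
    have h2 := mul_le_mul_of_nonneg_right (mul_le_mul_of_nonneg_right h1
      (by positivity : (0 : ℝ) ≤ (r : ℝ) / (r + 1)))
      (by positivity : (0 : ℝ) ≤ (s : ℝ) ^ (1 + 1 / (r : ℝ)))
    rw [gt_iff_lt]
    linarith
  · obtain ⟨j, hj⟩ := hns.exists_coeff_ne_zero hFp hP hi hai haP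
    -- A nonzero linear coefficient forces the order of `g` to be at most one.
    have h1 : β.degree = 1 := by
      refine le_antisymm (not_lt.1 fun h => hj (hlowdeg _ ?_)) hβpos
      simpa using h
    rw [h1, Nat.cast_one, div_one] at hb
    rw [gt_iff_lt]
    linarith
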